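/- Let $\Bbbk$ be a field, let $0\le r\le n$ be integers, and let $W\subseteq\Bbbk^{n}$ be a linear realization of the uniform matroid $U_{r,n}$ on $[n]=\{1,\dots,n\}$; that is, for $B\subseteq[n]$, the coordinate projection $W\to\Bbbk^{B}$ is an isomorphism if and only if $|B|=r$. Let $W^\perp=\{y\in\Bbbk^{n} : \sum_i w_iy_i=0\text{ for all }w\in W\}$. Let $R=\operatorname{Sym}(W^*)$ and $R^\perp=\operatorname{Sym}((W^\perp)^*)$ be the coordinate rings of $W$ and $W^\perp$, put $S=R\otimes_\Bbbk R^\perp$, and let $f_i\in R$ and $g_i\in R^\perp$ be the restrictions of the $i$-th coordinate function to $W$ and to $W^\perp$, regarded as elements of $S$. Let $\mathfrak a=(f_1g_1,\dots,f_ng_n)\subseteq S$ be the ideal of pairs of $W$, and for $I,J\subseteq[n]$ put $\mathfrak p_{I,J}=(f_i : i\in I)+(g_j : j\in J)\subseteq S$. Then every associated prime of $S/\mathfrak a$ is one of $\mathfrak p_{[n],\emptyset}$, $\mathfrak p_{\emptyset,[n]}$ and $\mathfrak p_{[n],[n]}$. Moreover, if $0<r<n$, then $\mathfrak p_{[n],\emptyset}$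 and $\mathfrak p_{\emptyset,[n]}$ are associated primes of $S/\mathfrak a$, and $\mathfrak p_{[n],[n]}$ is an associated prime of $S/\mathfrak a$ if and only if $2\le r\le n-2$. -/

import Mathlib

open scoped TensorProduct

namespace IdealOfPairs

/-- The uniform matroid `U_{r,n}` on the ground set `Fin n`: a set is independent iff it has at
most `r` elements. -/
def uniformMatroid (r n : ℕ) : Matroid (Fin n) :=
  (IndepMatroid.ofFinite (E := Set.univ) Set.finite_univ (fun I : Set (Fin n) => I.ncard ≤ r)
    (by simp)
    (fun _ J hJ hIJ => (Set.ncard_le_ncard hIJ J.toFinite).trans hJ)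
    (by
      intro I J _ hJ hIJ
      obtain ⟨e, heJ, heI⟩ := Set.exists_mem_notMem_of_ncard_lt_ncard hIJ I.toFinite
      refine ⟨e, heJ, heI, ?_⟩
      rw [Set.ncard_insert_of_notMem heI I.toFinite]
      omega)
    (fun I _ => Set.subset_univ I)).matroid

section

variable {k : Type*} [Field k] {n : ℕ}

/-- `W ⊆ kⁿ` is a linear realization of the matroid `M` on `[n]`: the coordinate projection
`W → k^B` is an isomorphism iff `B` is a basis of `M`. -/
def IsRealization (W : Submodule k (Fin n → k)) (M : Matroid (Fin n)) : Prop :=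
  M.E = Set.univ ∧ ∀ B : Set (Fin n),
    Function.Bijective (fun (w : W) (i : B) => (w : Fin n → k) i) ↔ M.IsBase B

/-- `W^⊥ = (kⁿ/W)^*`, regarded as a subspace of `kⁿ` through the standard basis. -/
def perp (W : Submodule k (Fin n → k)) : Submodule k (Fin n → k) where
  carrier := {y | ∀ w ∈ W, ∑ i, w i * y i = 0}
  zero_mem' := by simp
  add_mem' := by
    intro a b ha hb w hw
    simp [mul_add, Finset.sum_add_distrib, ha w hw, hb w hw]
  smul_mem' := by
    intro c a ha w hw
    have h := ha w hw
    simp only [Pi.smul_apply, smul_eq_mul, mul_left_comm _ c, ← Finset.mul_sum, h, mul_zero]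

/-- The (polynomial) coordinate ring `k[V] = Sym(V^*)` of a subspace `V ⊆ kⁿ`. -/
abbrev CoordRing (V : Submodule k (Fin n → k)) : Type _ :=
  SymmetricAlgebra k (Module.Dual k V)

/-- The restriction to `V` of the `i`-th coordinate function of `kⁿ`, as an element of `k[V]`. -/
noncomputable def coord (V : Submodule k (Fin n → k)) (i : Fin n) : CoordRing V :=
  SymmetricAlgebra.ι k (Module.Dual k V) ((LinearMap.proj i : (Fin n → k) →ₗ[k] k) ∘ₗ V.subtype)

/-- `S = R ⊗ R^⊥`, where `R = k[W]` and `R^⊥ = k[W^⊥]`. -/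
abbrev PairRing (W : Submodule k (Fin n → k)) : Type _ :=
  CoordRing W ⊗[k] CoordRing (perp W)

/-- `f_i`, the restriction of the `i`-th coordinate to `W`, in `S`. -/
noncomputable def f (W : Submodule k (Fin n → k)) (i : Fin n) : PairRing W :=
  coord W i ⊗ₜ[k] 1

/-- `g_i`, the restriction of the `i`-th coordinate to `W^⊥`, in `S`. -/
noncomputable def g (W : Submodule k (Fin n → k)) (i : Fin n) : PairRing W :=
  1 ⊗ₜ[k] coord (perp W) i

/-- The ideal of pairs `𝔞 = (f_1 g_1, …, f_n g_n)`. -/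
noncomputable def pairIdeal (W : Submodule k (Fin n → k)) : Ideal (PairRing W) :=
  Ideal.span (Set.range fun i => f W i * g W i)

/-- The linear ideal `𝔭_{I,J} = (f_i : i ∈ I) + (g_j : j ∈ J)`. -/
noncomputable def linIdeal (W : Submodule k (Fin n → k)) (I J : Set (Fin n)) :
    Ideal (PairRing W) :=
  Ideal.span (f W '' I) ⊔ Ideal.span (g W '' J)

end

end IdealOfPairs

/-! Write `p` and `q` for the ideals of all `f i` and of all `g i`, and `a` for the ideal of pairs.
Any `r` of the `f i` generate `p` and any `n - r` of the `g i` generate `q`. If a prime `P` does not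
contain `p`, at least `n - r` of the `f i` lie outside `P`; their product `c` satisfies `c q ⊆ a ⊆
q`, so `a` and `q` agree locally at `P` (`exists_notMem_mul_mem`). Hence an associated prime not
containing `p` is `q`, and symmetrically; one containing both is the maximal ideal `p + q`
(`eq_cases`).

For `0 < r < n`, `p` and `q` annihilate the products of all `g i` and of all `f i` modulo `a`, while
`p + q` is associated iff `p ∩ q ≠ a`. If `r = 1`, the `f i` all generate `p`, which forces `p ∩ q =
a` (`inf_le_diagIdeal`); `n - r = 1` is symmetric. If both are at least 2, compare bidegree (1,1)
(`not_inf_le_pairIdeal`): `p ∩ q` fills a space of dimension `r (n - r) ≥ n`, but `a` gives the span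
of the `n` elements `f i * g i`, whose sum is zero. -/

section UniformPair

/-! ### Associated primes for an abstract uniform pair -/

variable {S : Type*} [CommRing S] {n r s : ℕ} {f g : Fin n → S}

/-- Two families `f, g` in a commutative ring that generate prime ideals whose sum is maximal, such
that any `r` of the `f i` generate the same ideal as all of them, and likewise any `s` of the
`g i`, where `r + s = n`. -/
structure IsUniformPair (f g : Fin n → S) (r s : ℕ) : Prop where
  add_eq : r + s = n
  span_left : ∀ T : Finset (Fin n), r ≤ T.card → Ideal.span (Set.range f) ≤ Ideal.span (f '' T)
  span_right : ∀ T : Finset (Fin n), s ≤ T.card → Ideal.span (Set.range g) ≤ Ideal.span (g '' T)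
  prime_left : (Ideal.span (Set.range f)).IsPrime
  prime_right : (Ideal.span (Set.range g)).IsPrime
  isMaximal_sup : (Ideal.span (Set.range f) ⊔ Ideal.span (Set.range g)).IsMaximal
  notMem_left : 0 < r → ∀ i, f i ∉ Ideal.span (Set.range g)
  notMem_right : 0 < s → ∀ i, g i ∉ Ideal.span (Set.range f)

/-- The ideal generated by the products `f i * g i`. -/
def diagIdeal (f g : Fin n → S) : Ideal S := Ideal.span (Set.range fun i => f i * g i)

theorem diagIdeal_comm (f g : Fin n → S) : diagIdeal f g = diagIdeal g f := by
  simp only [diagIdeal, mul_comm]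

theorem mul_mem_diagIdeal (f g : Fin n → S) (i : Fin n) : f i * g i ∈ diagIdeal f g :=
  Ideal.subset_span ⟨i, rfl⟩

theorem diagIdeal_le_left (f g : Fin n → S) : diagIdeal f g ≤ Ideal.span (Set.range f) := by
  rw [diagIdeal, Ideal.span_le]
  rintro _ ⟨i, rfl⟩
  exact Ideal.mul_mem_right _ _ (Ideal.subset_span ⟨i, rfl⟩)

theorem diagIdeal_le_right (f g : Fin n → S) : diagIdeal f g ≤ Ideal.span (Set.range g) :=
  diagIdeal_comm f g ▸ diagIdeal_le_left g f

theorem mul_mem_of_mem_span {A : Set S} {I : Ideal S} {c y : S} (hy : y ∈ Ideal.span A)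
    (h : ∀ z ∈ A, c * z ∈ I) : c * y ∈ I := by
  have : Ideal.span A ≤ Submodule.comap (LinearMap.mulLeft S c) I := Submodule.span_le.2 h
  exact this hy

theorem mem_associatedPrimes_quotient_iff [IsNoetherianRing S] {I P : Ideal S} :
    P ∈ associatedPrimes S (S ⧸ I) ↔ P.IsPrime ∧ ∃ x, ∀ a, a ∈ P ↔ a * x ∈ I := by
  rw [AssociatedPrimes.mem_iff, isAssociatedPrime_iff]
  refine and_congr_right fun _ => ?_
  rw [(Ideal.Quotient.mk_surjective (I := I)).exists]
  refine exists_congr fun x => ?_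
  rw [Ideal.ext_iff]
  refine forall_congr' fun a => ?_
  rw [Submodule.mem_colon_singleton, Submodule.mem_bot, Algebra.smul_def,
    Ideal.Quotient.algebraMap_eq, ← map_mul, Ideal.Quotient.eq_zero_iff_mem]

namespace IsUniformPair

theorem symm (h : IsUniformPair f g r s) : IsUniformPair g f s r where
  add_eq := (add_comm _ _).trans h.add_eq
  span_left := h.span_right
  span_right := h.span_left
  prime_left := h.prime_right
  prime_right := h.prime_left
  isMaximal_sup := sup_comm (Ideal.span (Set.range f)) _ ▸ h.isMaximal_sup
  notMem_left := h.notMem_right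
  notMem_right := h.notMem_left

theorem exists_notMem_mul_mem (h : IsUniformPair f g r s) {P : Ideal S} (hP : P.IsPrime)
    (hfP : ¬ Ideal.span (Set.range f) ≤ P) :
    ∃ c ∉ P, ∀ y ∈ Ideal.span (Set.range g), c * y ∈ diagIdeal f g := by
  classical
  let T : Finset (Fin n) := Finset.univ.filter fun i => f i ∉ P
  -- Otherwise at least `r` of the `f i` lie in `P`, and these already generate the whole ideal.
  have hT : s ≤ T.card := by
    by_contra! hlt
    have hc : Tᶜ.card = n - T.card := by simp [Finset.card_compl]
    have := h.add_eq
    refine hfP ((h.span_left Tᶜ (by omega)).trans (Ideal.span_le.2 ?_))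
    rintro _ ⟨i, hi, rfl⟩
    simpa [T] using hi
  refine ⟨∏ i ∈ T, f i, fun hmem => ?_, fun y hy =>
    mul_mem_of_mem_span (h.span_right T hT hy) ?_⟩
  · obtain ⟨i, hi, hiP⟩ := hP.prod_mem_iff.1 hmem
    exact (Finset.mem_filter.1 hi).2 hiP
  · rintro _ ⟨i, hi, rfl⟩
    rw [← Finset.prod_erase_mul T f hi, mul_assoc]
    exact Ideal.mul_mem_left _ _ (mul_mem_diagIdeal f g i)

theorem eq_right_of_not_le (h : IsUniformPair f g r s) {P : Ideal S} (hP : P.IsPrime) {x : S}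
    (hx : ∀ a, a ∈ P ↔ a * x ∈ diagIdeal f g) (hfP : ¬ Ideal.span (Set.range f) ≤ P) :
    x ∉ Ideal.span (Set.range g) ∧ P = Ideal.span (Set.range g) := by
  obtain ⟨c, hcP, hc⟩ := h.exists_notMem_mul_mem hP hfP
  have hxg : x ∉ Ideal.span (Set.range g) := fun hmem => hcP ((hx c).2 (hc x hmem))
  refine ⟨hxg, le_antisymm (fun a ha => ?_) fun y hy => ?_⟩
  · exact (h.prime_right.mem_or_mem (diagIdeal_le_right f g ((hx a).1 ha))).resolve_right hxg
  · exact (hP.mem_or_mem ((hx _).2 (Ideal.mul_mem_right x _ (hc y hy)))).resolve_left hcP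

/-- A prime of the form `(𝔞 : x)` other than the two generated by `f` and by `g`. -/
theorem eq_cases (h : IsUniformPair f g r s) {P : Ideal S} (hP : P.IsPrime) {x : S}
    (hx : ∀ a, a ∈ P ↔ a * x ∈ diagIdeal f g) :
    (x ∉ Ideal.span (Set.range f) ∧ P = Ideal.span (Set.range f)) ∨
      (x ∉ Ideal.span (Set.range g) ∧ P = Ideal.span (Set.range g)) ∨
      P = Ideal.span (Set.range f) ⊔ Ideal.span (Set.range g) := by
  by_cases hf : Ideal.span (Set.range f) ≤ P
  · by_cases hg : Ideal.span (Set.range g) ≤ P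
    · exact .inr (.inr (h.isMaximal_sup.eq_of_le hP.ne_top (sup_le hf hg)).symm)
    · exact .inl (h.symm.eq_right_of_not_le hP (diagIdeal_comm f g ▸ hx) hg)
  · exact .inr (.inl (h.eq_right_of_not_le hP hx hf))

theorem left_mem_associatedPrimes [IsNoetherianRing S] (h : IsUniformPair f g r s) (hs : 0 < s) :
    Ideal.span (Set.range f) ∈ associatedPrimes S (S ⧸ diagIdeal f g) := by
  refine mem_associatedPrimes_quotient_iff.2 ⟨h.prime_left, ∏ i, g i, fun a => ⟨fun ha => ?_,
    fun ha => (h.prime_left.mem_or_mem (diagIdeal_le_left f g ha)).resolve_right fun hmem => ?_⟩⟩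
  · rw [mul_comm]
    refine mul_mem_of_mem_span ha ?_
    rintro _ ⟨i, rfl⟩
    rw [← Finset.prod_erase_mul _ g (Finset.mem_univ i), mul_assoc, mul_comm (g i)]
    exact Ideal.mul_mem_left _ _ (mul_mem_diagIdeal f g i)
  · obtain ⟨i, -, hi⟩ := h.prime_left.prod_mem_iff.1 hmem
    exact h.notMem_right hs i hi

/-- Each `f i` alone generates the left ideal. An element of the intersection is `y * f 0` with `y`
in the prime generated by `g`, and `f 0 * g j` is a multiple of `f j * g j`. -/
theorem inf_le_diagIdeal (h : IsUniformPair f g r s) (hr : r = 1) :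
    Ideal.span (Set.range f) ⊓ Ideal.span (Set.range g) ≤ diagIdeal f g := by
  have hle (i : Fin n) : Ideal.span (Set.range f) ≤ Ideal.span {f i} := by
    simpa using h.span_left {i} (by simp [hr])
  have hn : 0 < n := by have := h.add_eq; omega
  intro x hx
  obtain ⟨y, rfl⟩ := Ideal.mem_span_singleton'.1 (hle ⟨0, hn⟩ hx.1)
  have hy := (h.prime_right.mem_or_mem hx.2).resolve_right (h.notMem_left (by omega) _)
  rw [mul_comm]
  refine mul_mem_of_mem_span hy ?_
  rintro _ ⟨j, rfl⟩
  obtain ⟨c, hc⟩ := Ideal.mem_span_singleton'.1 (hle j (Ideal.subset_span ⟨⟨0, hn⟩, rfl⟩))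
  rw [← hc, mul_assoc]
  exact Ideal.mul_mem_left _ _ (mul_mem_diagIdeal f g j)

/-- If the sum is `(𝔞 : x)`, then `g i * x` and `f i * x` lie in `𝔞`; primality puts `x` in both
ideals, yet `x ∉ 𝔞`. -/
theorem not_inf_le_of_sup_mem [IsNoetherianRing S] (h : IsUniformPair f g r s) (hr : 0 < r)
    (hs : 0 < s) (hm : Ideal.span (Set.range f) ⊔ Ideal.span (Set.range g) ∈
      associatedPrimes S (S ⧸ diagIdeal f g)) :
    ¬ Ideal.span (Set.range f) ⊓ Ideal.span (Set.range g) ≤ diagIdeal f g := by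
  obtain ⟨hP, x, hx⟩ := mem_associatedPrimes_quotient_iff.1 hm
  have hn : 0 < n := by have := h.add_eq; omega
  let i : Fin n := ⟨0, hn⟩
  intro hle
  refine hP.ne_top ((Ideal.eq_top_iff_one _).2 ((hx 1).2 ?_))
  rw [one_mul]
  refine hle ⟨?_, ?_⟩
  · exact (h.prime_left.mem_or_mem (diagIdeal_le_left f g ((hx (g i)).1
      (Ideal.mem_sup_right (Ideal.subset_span ⟨i, rfl⟩))))).resolve_left (h.notMem_right hs i)
  · exact (h.prime_right.mem_or_mem (diagIdeal_le_right f g ((hx (f i)).1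
      (Ideal.mem_sup_left (Ideal.subset_span ⟨i, rfl⟩))))).resolve_left (h.notMem_left hr i)

/-- The nonzero module `(p ∩ q)/𝔞` has an associated prime; its witness `x` lies in both `p` and
`q`, which excludes the other two cases of `eq_cases`. -/
theorem sup_mem_associatedPrimes [IsNoetherianRing S] (h : IsUniformPair f g r s)
    (hq : ¬ Ideal.span (Set.range f) ⊓ Ideal.span (Set.range g) ≤ diagIdeal f g) :
    Ideal.span (Set.range f) ⊔ Ideal.span (Set.range g) ∈
      associatedPrimes S (S ⧸ diagIdeal f g) := by
  set N : Submodule S (S ⧸ diagIdeal f g) :=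
    Submodule.map (diagIdeal f g).mkQ (Ideal.span (Set.range f) ⊓ Ideal.span (Set.range g)) with hN
  have : Nontrivial N := by
    rw [Submodule.nontrivial_iff_ne_bot]
    rwa [Ne, hN, ← LinearMap.le_ker_iff_map, Submodule.ker_mkQ]
  obtain ⟨P, hP⟩ := associatedPrimes.nonempty S N
  obtain ⟨hPp, y, hyP⟩ := isAssociatedPrime_iff.1 hP
  obtain ⟨x, hx, hxy⟩ := Submodule.mem_map.1 y.2
  have key : ∀ a, a ∈ P ↔ a * x ∈ diagIdeal f g := fun a => by
    rw [hyP, Submodule.mem_colon_singleton, Submodule.mem_bot, ← Submodule.coe_eq_zero,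
      Submodule.coe_smul, ← hxy, ← map_smul, Submodule.mkQ_apply, Submodule.Quotient.mk_eq_zero,
      smul_eq_mul]
  rcases h.eq_cases hPp key with ⟨h1, -⟩ | ⟨h1, -⟩ | rfl
  · exact absurd hx.1 h1
  · exact absurd hx.2 h1
  · exact associatedPrimes.subset_of_injective N.injective_subtype hP

end IsUniformPair

end UniformPair

/-! ### Symmetric algebras: linear parts, restrictions and kernels -/

namespace SymmetricAlgebra

section LinearPart

variable {k M : Type*} [CommRing k] [AddCommGroup M] [Module k M] [Module kᵐᵒᵖ M]
  [IsCentralScalar k M]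

/-- The degree one component of an element of the symmetric algebra. -/
noncomputable def linearPart : SymmetricAlgebra k M →ₗ[k] M :=
  TrivSqZeroExt.sndHom k M ∘ₗ (lift (TrivSqZeroExt.inrHom k M)).toLinearMap

theorem linearPart_ι (m : M) : linearPart (ι k M m) = m := by
  simp [linearPart]

/-- In `k ⊕ M` with `M` of square zero, only the constant term of `a` contributes. -/
theorem linearPart_mul_ι (a : SymmetricAlgebra k M) (m : M) :
    linearPart (a * ι k M m) = algebraMapInv a • m := by
  have h : (TrivSqZeroExt.fstHom k k M).comp (lift (TrivSqZeroExt.inrHom k M)) =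
      algebraMapInv := by
    ext x
    simp [algebraMapInv_ι]
  rw [← h]
  simp [linearPart, TrivSqZeroExt.snd_mul]

theorem ι_injective : Function.Injective (ι k M) :=
  Function.LeftInverse.injective linearPart_ι

end LinearPart

section Ker

variable {k M N C : Type*} [CommRing k] [AddCommGroup M] [Module k M] [AddCommGroup N] [Module k N]
  [CommRing C] [Algebra k C]

/-- `G ∘ F` is the identity modulo `I`, as seen on generators, so `F x = 0` forces `x ∈ I`. -/
theorem ker_eq_of_section (F : SymmetricAlgebra k M ⊗[k] SymmetricAlgebra k N →ₐ[k] C)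
    (G : C →ₐ[k] SymmetricAlgebra k M ⊗[k] SymmetricAlgebra k N)
    {I : Ideal (SymmetricAlgebra k M ⊗[k] SymmetricAlgebra k N)} (hI : I ≤ RingHom.ker F)
    (hl : ∀ m, G (F (ι k M m ⊗ₜ 1)) - ι k M m ⊗ₜ 1 ∈ I)
    (hr : ∀ m, G (F (1 ⊗ₜ ι k N m)) - 1 ⊗ₜ ι k N m ∈ I) : RingHom.ker F = I := by
  have h : (Ideal.Quotient.mkₐ k I).comp (G.comp F) = Ideal.Quotient.mkₐ k I := by
    apply Algebra.TensorProduct.ext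
    · ext m
      exact Ideal.Quotient.eq.2 (hl m)
    · ext m
      exact Ideal.Quotient.eq.2 (hr m)
  refine le_antisymm (fun x hx => ?_) hI
  have hx' := DFunLike.congr_fun h x
  rw [RingHom.mem_ker] at hx
  rw [← Ideal.Quotient.eq_zero_iff_mem]
  simpa [hx] using hx'.symm

/-- Restriction of functions on a product of two spaces to the second factor. -/
noncomputable def restrictRight (k M N : Type*) [CommRing k] [AddCommGroup M] [Module k M]
    [AddCommGroup N] [Module k N] :
    SymmetricAlgebra k M ⊗[k] SymmetricAlgebra k N →ₐ[k] SymmetricAlgebra k N :=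
  Algebra.TensorProduct.lift ((Algebra.ofId k _).comp algebraMapInv) (AlgHom.id k _)
    fun _ _ => .all _ _

/-- Restriction of functions on a product of two spaces to the first factor. -/
noncomputable def restrictLeft (k M N : Type*) [CommRing k] [AddCommGroup M] [Module k M]
    [AddCommGroup N] [Module k N] :
    SymmetricAlgebra k M ⊗[k] SymmetricAlgebra k N →ₐ[k] SymmetricAlgebra k M :=
  Algebra.TensorProduct.lift (AlgHom.id k _) ((Algebra.ofId k _).comp algebraMapInv)
    fun _ _ => .all _ _

@[simp] theorem restrictRight_tmul_one (m : M) : restrictRight k M N (ι k M m ⊗ₜ 1) = 0 := by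
  simp [restrictRight, algebraMapInv_ι]

@[simp] theorem restrictRight_one_tmul (m : N) :
    restrictRight k M N (1 ⊗ₜ ι k N m) = ι k N m := by
  simp [restrictRight]

@[simp] theorem restrictLeft_tmul_one (m : M) :
    restrictLeft k M N (ι k M m ⊗ₜ 1) = ι k M m := by
  simp [restrictLeft]

@[simp] theorem restrictLeft_one_tmul (m : N) : restrictLeft k M N (1 ⊗ₜ ι k N m) = 0 := by
  simp [restrictLeft, algebraMapInv_ι]

theorem isNoetherianRing_tensorProduct {k M N : Type*} [Field k] [AddCommGroup M] [Module k M]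
    [AddCommGroup N] [Module k N] [Module.Finite k M] [Module.Finite k N] :
    IsNoetherianRing (SymmetricAlgebra k M ⊗[k] SymmetricAlgebra k N) := by
  have hM : Algebra.FiniteType k (SymmetricAlgebra k M) := .equiv inferInstance
    (equivMvPolynomial (Module.finBasis k M)).symm
  have hN : Algebra.FiniteType k (SymmetricAlgebra k N) := .equiv inferInstance
    (equivMvPolynomial (Module.finBasis k N)).symm
  have : Algebra.FiniteType k (SymmetricAlgebra k M ⊗[k] SymmetricAlgebra k N) :=
    Algebra.FiniteType.trans hM inferInstance
  exact Algebra.FiniteType.isNoetherianRing k _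

end Ker

end SymmetricAlgebra

/-! ### Coordinate functions on subspaces -/

namespace IdealOfPairs

section

variable {k : Type*} [Field k] {n : ℕ}

/-- The restriction to `V` of the `i`-th coordinate function of `kⁿ`. -/
def coordFun (V : Submodule k (Fin n → k)) (i : Fin n) : Module.Dual k V :=
  LinearMap.proj i ∘ₗ V.subtype

@[simp] theorem coordFun_apply (V : Submodule k (Fin n → k)) (i : Fin n) (v : V) :
    coordFun V i v = (v : Fin n → k) i := rfl

theorem f_eq (W : Submodule k (Fin n → k)) (i : Fin n) :
    f W i = SymmetricAlgebra.ι k _ (coordFun W i) ⊗ₜ 1 := rfl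

theorem g_eq (W : Submodule k (Fin n → k)) (i : Fin n) :
    g W i = 1 ⊗ₜ SymmetricAlgebra.ι k _ (coordFun (perp W) i) := rfl

/-- A vector of `V` is determined by any `t` of its coordinates. -/
def IsSeparatedBy (V : Submodule k (Fin n → k)) (t : ℕ) : Prop :=
  ∀ T : Finset (Fin n), t ≤ T.card → ∀ v ∈ V, (∀ i ∈ T, v i = 0) → v = 0

/-- Restriction to the coordinates in `T` is injective, so every functional factors through it by a
left inverse. -/
theorem span_coordFun_eq_top {V : Submodule k (Fin n → k)} {T : Finset (Fin n)}
    (h : ∀ v ∈ V, (∀ i ∈ T, v i = 0) → v = 0) :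
    Submodule.span k (coordFun V '' T) = ⊤ := by
  have hinj : LinearMap.ker (LinearMap.pi fun i : T => coordFun V i) = ⊥ := by
    refine (Submodule.eq_bot_iff _).2 fun v hv => ?_
    refine Subtype.ext (h v v.2 fun i hi => ?_)
    exact congr_fun (LinearMap.mem_ker.1 hv) ⟨i, hi⟩
  obtain ⟨l, hl⟩ := LinearMap.exists_leftInverse_of_injective _ hinj
  refine eq_top_iff.2 fun ψ _ => ?_
  have : ψ = ∑ i : T, ψ (l (Pi.single i 1)) • coordFun V i := by
    ext v
    conv_lhs => rw [← LinearMap.id_apply (R := k) v, ← hl, LinearMap.comp_apply,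
      ← Finset.univ_sum_single (LinearMap.pi (fun i : T => coordFun V i) v), map_sum, map_sum]
    simp only [LinearMap.sum_apply, LinearMap.smul_apply, smul_eq_mul]
    refine Finset.sum_congr rfl fun i _ => ?_
    rw [mul_comm, ← smul_eq_mul, LinearMap.pi_apply, coordFun_apply, ← map_smul, ← map_smul,
      ← Pi.single_smul, smul_eq_mul, mul_one]
  rw [this]
  exact Submodule.sum_mem _ fun i _ =>
    Submodule.smul_mem _ _ (Submodule.subset_span ⟨i, i.2, rfl⟩)

theorem finrank_le_card {V : Submodule k (Fin n → k)} {T : Finset (Fin n)}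
    (h : ∀ v ∈ V, (∀ i ∈ T, v i = 0) → v = 0) : Module.finrank k V ≤ T.card := by
  classical
  have h1 := finrank_span_finset_le_card (R := k) (T.image (coordFun V))
  rw [Set.finrank, Finset.coe_image, span_coordFun_eq_top h, finrank_top,
    Subspace.dual_finrank_eq] at h1
  exact h1.trans Finset.card_image_le

/-- A vanishing coordinate could be dropped from a separating `t`-set, giving dimension at most `t -
1`. -/
theorem IsSeparatedBy.coordFun_ne_zero {V : Submodule k (Fin n → k)} {t : ℕ}
    (h : IsSeparatedBy V t) (ht : 0 < t) (htn : t ≤ n) (hV : t ≤ Module.finrank k V) (i : Fin n) :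
    coordFun V i ≠ 0 := by
  intro h0
  obtain ⟨T, hiT, hT⟩ := Finset.exists_superset_card_eq (s := {i}) (n := t) (by simpa) (by simpa)
  rw [Finset.singleton_subset_iff] at hiT
  have := finrank_le_card (V := V) (T := T.erase i) fun v hv hvT => h T hT.ge v hv fun j hj => by
    by_cases hji : j = i
    · subst hji
      exact LinearMap.congr_fun h0 ⟨v, hv⟩
    · exact hvT j (Finset.mem_erase.2 ⟨hji, hj⟩)
  rw [Finset.card_erase_of_mem hiT] at this
  omega

theorem uniformMatroid_isBase {r : ℕ} {B : Set (Fin n)} (hB : B.ncard = r) :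
    (uniformMatroid r n).IsBase B := by
  rw [Matroid.isBase_iff_maximal_indep]
  have hind (I : Set (Fin n)) : (uniformMatroid r n).Indep I ↔ I.ncard ≤ r := by
    simp [uniformMatroid]
  refine ⟨(hind B).2 hB.le, fun J hJ hBJ => ?_⟩
  exact (Set.eq_of_subset_of_ncard_le hBJ (((hind J).1 hJ).trans hB.ge) J.toFinite).ge

/-! ### Realizations of the uniform matroid and their duals -/

section Realization

variable {r : ℕ} {W : Submodule k (Fin n → k)}

theorem IsRealization.bijective (hW : IsRealization W (uniformMatroid r n)) {B : Finset (Fin n)}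
    (hB : B.card = r) : Function.Bijective fun (w : W) (i : B) => (w : Fin n → k) i :=
  (hW.2 B).2 (uniformMatroid_isBase (by rwa [Set.ncard_coe_finset]))

theorem IsRealization.isSeparatedBy (hW : IsRealization W (uniformMatroid r n)) :
    IsSeparatedBy W r := by
  intro T hT w hw hwT
  obtain ⟨B, hBT, hB⟩ := Finset.exists_subset_card_eq hT
  have := (hW.bijective hB).injective (a₁ := ⟨w, hw⟩) (a₂ := 0) (by
    ext i
    exact hwT i (hBT i.2))
  exact congr_arg Subtype.val this

theorem IsRealization.isSeparatedBy_perp (hW : IsRealization W (uniformMatroid r n)) (hr : r ≤ n) :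
    IsSeparatedBy (perp W) (n - r) := by
  classical
  intro T hT y hy hyT
  have hc : Tᶜ.card = n - T.card := by simp [Finset.card_compl]
  obtain ⟨B, hTB, hB⟩ := Finset.exists_superset_card_eq (s := Tᶜ) (n := r) (by omega) (by simpa)
  ext i
  by_cases hi : i ∈ B
  · obtain ⟨w, hw⟩ := (hW.bijective hB).surjective (Pi.single ⟨i, hi⟩ 1)
    rw [Pi.zero_apply, ← hy w w.2, Finset.sum_eq_single i]
    · simpa using congr_arg (· * y i) (congr_fun hw ⟨i, hi⟩).symm
    · intro j _ hji
      by_cases hj : j ∈ B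
      · have := congr_fun hw ⟨j, hj⟩
        rw [Pi.single_eq_of_ne (by simpa using hji)] at this
        exact mul_eq_zero_of_left this _
      · rw [hyT j (by_contra fun h => hj (hTB (Finset.mem_compl.2 h))), mul_zero]
    · simp
  · exact hyT i (by_contra fun h => hi (hTB (Finset.mem_compl.2 h)))

theorem IsRealization.finrank_eq (hW : IsRealization W (uniformMatroid r n)) (hr : r ≤ n) :
    Module.finrank k W = r := by
  obtain ⟨B, -, hB⟩ := Finset.exists_subset_card_eq (s := (Finset.univ : Finset (Fin n))) (n := r)
    (by simpa)
  have := (LinearEquiv.ofBijective (LinearMap.pi fun i : B => coordFun W i)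
    (hW.bijective hB)).finrank_eq
  simpa [hB] using this

theorem le_finrank_add_finrank_perp (W : Submodule k (Fin n → k)) :
    n ≤ Module.finrank k W + Module.finrank k (perp W) := by
  -- `L y` is the functional on `W` given by pairing with `y`, so its kernel is `perp W`.
  let L : (Fin n → k) →ₗ[k] Module.Dual k W :=
    ∑ i, LinearMap.toSpanSingleton k _ (coordFun W i) ∘ₗ LinearMap.proj i
  have hker : LinearMap.ker L = perp W := by
    ext y
    simp only [LinearMap.mem_ker, LinearMap.ext_iff]
    simp [L, perp, mul_comm]
  have h1 := L.finrank_range_add_finrank_ker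
  rw [hker, Module.finrank_fin_fun] at h1
  have h2 := (LinearMap.range L).finrank_le
  rw [Subspace.dual_finrank_eq] at h2
  omega

end Realization

/-! ### The families `f` and `g` form a uniform pair -/

theorem mem_span_image {M S : Type*} [AddCommGroup M] [Module k M] [CommRing S] [Algebra k S]
    (L : M →ₗ[k] S) {A : Set M} (hA : Submodule.span k A = ⊤) (m : M) :
    L m ∈ Ideal.span (L '' A) := by
  have : Submodule.span k A ≤ ((Ideal.span (L '' A)).restrictScalars k).comap L :=
    Submodule.span_le.2 fun x hx => Ideal.subset_span ⟨x, hx, rfl⟩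
  exact this (hA ▸ Submodule.mem_top)

/-- The linear forms on the first factor, as elements of the coordinate ring of the product. -/
noncomputable def inlForm (W : Submodule k (Fin n → k)) : Module.Dual k W →ₗ[k] PairRing W :=
  (Algebra.TensorProduct.includeLeft (R := k) (S := k)).toLinearMap ∘ₗ SymmetricAlgebra.ι k _

/-- The linear forms on the second factor, as elements of the coordinate ring of the product. -/
noncomputable def inrForm (W : Submodule k (Fin n → k)) :
    Module.Dual k (perp W) →ₗ[k] PairRing W :=
  (Algebra.TensorProduct.includeRight (R := k)).toLinearMap ∘ₗ SymmetricAlgebra.ι k _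

theorem inlForm_mem {W : Submodule k (Fin n → k)} {T : Finset (Fin n)}
    (h : ∀ v ∈ W, (∀ i ∈ T, v i = 0) → v = 0) (φ : Module.Dual k W) :
    inlForm W φ ∈ Ideal.span (f W '' T) := by
  have := mem_span_image (inlForm W) (span_coordFun_eq_top h) φ
  rwa [Set.image_image] at this

theorem inrForm_mem {W : Submodule k (Fin n → k)} {T : Finset (Fin n)}
    (h : ∀ v ∈ perp W, (∀ i ∈ T, v i = 0) → v = 0) (φ : Module.Dual k (perp W)) :
    inrForm W φ ∈ Ideal.span (g W '' T) := by
  have := mem_span_image (inrForm W) (span_coordFun_eq_top h) φ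
  rwa [Set.image_image] at this

theorem tmul_one_mem_span_range (W : Submodule k (Fin n → k)) (φ : Module.Dual k W) :
    SymmetricAlgebra.ι k _ φ ⊗ₜ[k] (1 : CoordRing (perp W)) ∈ Ideal.span (Set.range (f W)) := by
  rw [← Set.image_univ, ← Finset.coe_univ]
  exact inlForm_mem (fun v _ hv => funext fun i => hv i (Finset.mem_univ i)) φ

theorem one_tmul_mem_span_range (W : Submodule k (Fin n → k)) (φ : Module.Dual k (perp W)) :
    (1 : CoordRing W) ⊗ₜ[k] SymmetricAlgebra.ι k _ φ ∈ Ideal.span (Set.range (g W)) := by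
  rw [← Set.image_univ, ← Finset.coe_univ]
  exact inrForm_mem (fun v _ hv => funext fun i => hv i (Finset.mem_univ i)) φ

theorem ker_restrictRight (W : Submodule k (Fin n → k)) :
    RingHom.ker (SymmetricAlgebra.restrictRight k (Module.Dual k W) (Module.Dual k (perp W))) =
      Ideal.span (Set.range (f W)) := by
  refine SymmetricAlgebra.ker_eq_of_section _ Algebra.TensorProduct.includeRight ?_ ?_ ?_
  · rw [Ideal.span_le]
    rintro _ ⟨i, rfl⟩
    simp [f_eq]
  · intro φ
    simpa using tmul_one_mem_span_range W φ
  · simp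

theorem ker_restrictLeft (W : Submodule k (Fin n → k)) :
    RingHom.ker (SymmetricAlgebra.restrictLeft k (Module.Dual k W) (Module.Dual k (perp W))) =
      Ideal.span (Set.range (g W)) := by
  refine SymmetricAlgebra.ker_eq_of_section _ Algebra.TensorProduct.includeLeft ?_ ?_ ?_
  · rw [Ideal.span_le]
    rintro _ ⟨i, rfl⟩
    simp [g_eq]
  · simp
  · intro φ
    simpa using one_tmul_mem_span_range W φ

theorem isMaximal_sup (W : Submodule k (Fin n → k)) :
    (Ideal.span (Set.range (f W)) ⊔ Ideal.span (Set.range (g W))).IsMaximal := by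
  let F : PairRing W →ₐ[k] k := SymmetricAlgebra.algebraMapInv.comp
    (SymmetricAlgebra.restrictRight k (Module.Dual k W) (Module.Dual k (perp W)))
  have hF : RingHom.ker F =
      Ideal.span (Set.range (f W)) ⊔ Ideal.span (Set.range (g W)) := by
    refine SymmetricAlgebra.ker_eq_of_section _ (Algebra.ofId k _) ?_ ?_ ?_
    · refine sup_le (Ideal.span_le.2 ?_) (Ideal.span_le.2 ?_)
      · rintro _ ⟨i, rfl⟩
        simp [F, f_eq]
      · rintro _ ⟨i, rfl⟩
        simp [F, g_eq, SymmetricAlgebra.algebraMapInv_ι]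
    · intro φ
      simpa [F] using Ideal.mem_sup_left (tmul_one_mem_span_range W φ)
    · intro φ
      simpa [F, SymmetricAlgebra.algebraMapInv_ι] using
        Ideal.mem_sup_right (one_tmul_mem_span_range W φ)
  rw [← hF]
  exact RingHom.ker_isMaximal_of_surjective F.toRingHom fun c =>
    ⟨algebraMap k _ c, F.commutes c⟩

theorem IsRealization.isUniformPair {r : ℕ} {W : Submodule k (Fin n → k)} (hr : r ≤ n)
    (hW : IsRealization W (uniformMatroid r n)) : IsUniformPair (f W) (g W) r (n - r) where
  add_eq := by omega
  span_left T hT := by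
    rw [Ideal.span_le]
    rintro _ ⟨i, rfl⟩
    exact inlForm_mem (hW.isSeparatedBy T hT) (coordFun W i)
  span_right T hT := by
    rw [Ideal.span_le]
    rintro _ ⟨i, rfl⟩
    exact inrForm_mem (hW.isSeparatedBy_perp hr T hT) (coordFun (perp W) i)
  prime_left := ker_restrictRight W ▸ RingHom.ker_isPrime _
  prime_right := ker_restrictLeft W ▸ RingHom.ker_isPrime _
  isMaximal_sup := isMaximal_sup W
  notMem_left h i := by
    rw [← ker_restrictLeft, RingHom.mem_ker, f_eq, SymmetricAlgebra.restrictLeft_tmul_one]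
    exact (map_ne_zero_iff _ SymmetricAlgebra.ι_injective).2
      (hW.isSeparatedBy.coordFun_ne_zero h hr (hW.finrank_eq hr).ge i)
  notMem_right h i := by
    rw [← ker_restrictRight, RingHom.mem_ker, g_eq, SymmetricAlgebra.restrictRight_one_tmul]
    refine (map_ne_zero_iff _ SymmetricAlgebra.ι_injective).2
      ((hW.isSeparatedBy_perp hr).coordFun_ne_zero h (Nat.sub_le _ _) ?_ i)
    have := le_finrank_add_finrank_perp W
    rw [hW.finrank_eq hr] at this
    omega

/-! ### Dimension count in bidegree (1,1) -/

/-- The component of bidegree `(1, 1)` of a function on `W × W^⊥`. -/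
noncomputable def bilinearPart (W : Submodule k (Fin n → k)) :
    PairRing W →ₗ[k] Module.Dual k W ⊗[k] Module.Dual k (perp W) :=
  TensorProduct.map SymmetricAlgebra.linearPart SymmetricAlgebra.linearPart

theorem f_mul_g (W : Submodule k (Fin n → k)) (i j : Fin n) : f W i * g W j =
    SymmetricAlgebra.ι k _ (coordFun W i) ⊗ₜ SymmetricAlgebra.ι k _ (coordFun (perp W) j) := by
  simp [f_eq, g_eq]

theorem bilinearPart_f_mul_g (W : Submodule k (Fin n → k)) (i j : Fin n) :
    bilinearPart W (f W i * g W j) = coordFun W i ⊗ₜ coordFun (perp W) j := by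
  rw [f_mul_g, bilinearPart, TensorProduct.map_tmul, SymmetricAlgebra.linearPart_ι,
    SymmetricAlgebra.linearPart_ι]

theorem bilinearPart_mem {W : Submodule k (Fin n → k)} {x : PairRing W} (hx : x ∈ pairIdeal W) :
    bilinearPart W x ∈
      Submodule.span k (Set.range fun i => coordFun W i ⊗ₜ[k] coordFun (perp W) i) := by
  obtain ⟨c, rfl⟩ := Ideal.mem_span_range_iff_exists_fun.1 hx
  rw [map_sum]
  refine Submodule.sum_mem _ fun i _ => ?_
  rw [f_mul_g]
  induction c i using TensorProduct.induction_on with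
  | zero => simp
  | add x y hx hy =>
    rw [add_mul, map_add]
    exact add_mem hx hy
  | tmul a b =>
    rw [Algebra.TensorProduct.tmul_mul_tmul, bilinearPart, TensorProduct.map_tmul,
      SymmetricAlgebra.linearPart_mul_ι, SymmetricAlgebra.linearPart_mul_ι,
      TensorProduct.smul_tmul_smul]
    exact Submodule.smul_mem _ _ (Submodule.subset_span ⟨i, rfl⟩)

/-- As a bilinear form on `W × W^⊥`, the sum is the standard pairing. -/
theorem sum_coordFun_tmul (W : Submodule k (Fin n → k)) :
    ∑ i, coordFun W i ⊗ₜ[k] coordFun (perp W) i = 0 := by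
  apply (TensorProduct.dualDistribEquiv k W (perp W)).injective
  rw [map_zero, map_sum]
  apply TensorProduct.ext'
  intro w y
  simpa [TensorProduct.dualDistribEquivOfBasis] using y.2 w w.2

theorem finrank_span_range_lt {V : Type*} [AddCommGroup V] [Module k V] {v : Fin n → V}
    (hn : 0 < n) (hv : ∑ i, v i = 0) : Module.finrank k (Submodule.span k (Set.range v)) < n := by
  have h := finrank_range_le_card (R := k) v
  rw [Fintype.card_fin] at h
  refine lt_of_le_of_ne h fun heq => ?_
  have hli : LinearIndependent k v := by
    rw [linearIndependent_iff_card_eq_finrank_span, Fintype.card_fin]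
    exact heq.symm
  have := Fintype.linearIndependent_iff.1 hli (fun _ => 1) (by simpa using hv) ⟨0, hn⟩
  exact one_ne_zero this

theorem not_inf_le_pairIdeal {W : Submodule k (Fin n → k)}
    (h : n ≤ Module.finrank k W * Module.finrank k (perp W)) (hn : 0 < n) :
    ¬ Ideal.span (Set.range (f W)) ⊓ Ideal.span (Set.range (g W)) ≤ pairIdeal W := by
  intro hle
  have hspan (V : Submodule k (Fin n → k)) :
      Submodule.span k (Set.range (coordFun V)) = ⊤ := by
    simpa using span_coordFun_eq_top (V := V) (T := Finset.univ)
      (fun v _ hv => by ext i; simpa using hv i)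
  have htop : Submodule.span k (Set.range fun i => coordFun W i ⊗ₜ[k] coordFun (perp W) i) = ⊤ := by
    rw [eq_top_iff, ← TensorProduct.map₂_mk_top_top_eq_top, ← hspan W, ← hspan (perp W),
      Submodule.map₂_span_span, Submodule.span_le]
    rintro _ ⟨_, ⟨i, rfl⟩, _, ⟨j, rfl⟩, rfl⟩
    have := bilinearPart_mem (hle (x := f W i * g W j)
      ⟨Ideal.mul_mem_right _ _ (Ideal.subset_span ⟨i, rfl⟩),
        Ideal.mul_mem_left _ _ (Ideal.subset_span ⟨j, rfl⟩)⟩)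
    rwa [bilinearPart_f_mul_g] at this
  have hlt := finrank_span_range_lt (k := k)
    (v := fun i => coordFun W i ⊗ₜ[k] coordFun (perp W) i) hn (sum_coordFun_tmul W)
  rw [htop, finrank_top, Module.finrank_tensorProduct, Subspace.dual_finrank_eq,
    Subspace.dual_finrank_eq] at hlt
  omega

end

end IdealOfPairs

/-! ### The main theorem -/

theorem corollary3p13 {k : Type*} [Field k] {n r : ℕ} (hr : r ≤ n)
    (W : Submodule k (Fin n → k))
    (hW : IdealOfPairs.IsRealization W (IdealOfPairs.uniformMatroid r n)) :
    associatedPrimes (IdealOfPairs.PairRing W)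
        (IdealOfPairs.PairRing W ⧸ IdealOfPairs.pairIdeal W) ⊆
      {IdealOfPairs.linIdeal W Set.univ ∅, IdealOfPairs.linIdeal W ∅ Set.univ,
        IdealOfPairs.linIdeal W Set.univ Set.univ} ∧
    (0 < r → r < n →
      IdealOfPairs.linIdeal W Set.univ ∅ ∈ associatedPrimes (IdealOfPairs.PairRing W)
        (IdealOfPairs.PairRing W ⧸ IdealOfPairs.pairIdeal W) ∧
      IdealOfPairs.linIdeal W ∅ Set.univ ∈ associatedPrimes (IdealOfPairs.PairRing W)
        (IdealOfPairs.PairRing W ⧸ IdealOfPairs.pairIdeal W) ∧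
      (IdealOfPairs.linIdeal W Set.univ Set.univ ∈ associatedPrimes (IdealOfPairs.PairRing W)
        (IdealOfPairs.PairRing W ⧸ IdealOfPairs.pairIdeal W) ↔ 2 ≤ r ∧ r + 2 ≤ n)) := by
  have hN : IsNoetherianRing (IdealOfPairs.PairRing W) :=
    SymmetricAlgebra.isNoetherianRing_tensorProduct
  have hU := hW.isUniformPair hr
  have ha : IdealOfPairs.pairIdeal W =
    diagIdeal (IdealOfPairs.f W) (IdealOfPairs.g W) := rfl
  have h1 : IdealOfPairs.linIdeal W Set.univ ∅ =
      Ideal.span (Set.range (IdealOfPairs.f W)) := by simp [IdealOfPairs.linIdeal]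
  have h2 : IdealOfPairs.linIdeal W ∅ Set.univ =
      Ideal.span (Set.range (IdealOfPairs.g W)) := by simp [IdealOfPairs.linIdeal]
  have h3 : IdealOfPairs.linIdeal W Set.univ Set.univ =
      Ideal.span (Set.range (IdealOfPairs.f W)) ⊔ Ideal.span (Set.range (IdealOfPairs.g W)) := by
    simp [IdealOfPairs.linIdeal]
  rw [h1, h2, h3, ha]
  refine ⟨fun P hP => ?_, fun h0r hrn => ⟨hU.left_mem_associatedPrimes (by omega), ?_,
    fun hm => ?_, fun h => ?_⟩⟩
  · obtain ⟨hPp, x, hx⟩ := mem_associatedPrimes_quotient_iff.1 hP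
    rcases hU.eq_cases hPp hx with ⟨-, h⟩ | ⟨-, h⟩ | h <;> simp [h]
  · rw [diagIdeal_comm]
    exact hU.symm.left_mem_associatedPrimes h0r
  · have hnot := hU.not_inf_le_of_sup_mem h0r (by omega) hm
    by_contra hlt
    rcases (by omega : r = 1 ∨ n - r = 1) with h | h
    · exact hnot (hU.inf_le_diagIdeal h)
    · rw [inf_comm, diagIdeal_comm] at hnot
      exact hnot (hU.symm.inf_le_diagIdeal h)
  · refine hU.sup_mem_associatedPrimes (IdealOfPairs.not_inf_le_pairIdeal ?_ (by omega))
    have hperp := IdealOfPairs.le_finrank_add_finrank_perp W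
    rw [hW.finrank_eq hr] at hperp ⊢
    -- With `d = dim W^⊥`, both `r` and `d` are at least 2, so `r * d ≥ r + d ≥ n`.
    nlinarith
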